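/- **Setting.** Let $L/K$ be a cyclic Galois extension of fields of finite degree $n$, $\sigma$ a generator of $\mathrm{Gal}(L/K)$, and $R=L[x;\sigma]$ the skew polynomial ring, with $xa=a^{\sigma}x$ for $a\in L$. Let $K'\le K$ be a subfield with $[K:K']<\infty$, let $\rho\in\mathrm{Aut}(L/K')$ and $\eta\in L$. Let $F\in K[y]$ be monic and irreducible of degree $s$ with constant coefficient $F_0$, $F\neq y$, and put $R_F=R/RF(x^n)$. For an integer $k\ge 0$ put $$S_{n,s,k}(\eta,\rho,F)=\{a+RF(x^n):\ a\in R,\ \deg a\le sk,\ a_{sk}=\eta\,a_0^{\rho}\}\subseteq R_F ,$$ where $a_i$ is the coefficient of $x^i$ in $a$, and assume that $$N_{L:K'}(\eta)\,N_{K:K'}\big((-1)^{sk(n-1)}F_0^{k}\big)\neq 1 .$$ Fix a ring isomorphism $R_F\cong M_m(D)$ with $D$ a division ring, and regard $S_{n,s,k}(\eta,\rho,F)$ as a subset of $M_m(D)$. (If $K$ is finite, then $D\cong E_F:=K[y]/(F)$ and $m=n$.) For an additive subgroup $\mathcal C$ of $M_m(D)$ let $$\mathcal I_\ell(\mathcal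 C)=\{A: A\mathcal C\subseteq\mathcal C\},\qquad \mathcal I_r(\mathcal C)=\{A:\mathcal CA\subseteq\mathcal C\},$$ $$C(\mathcal C)=\{A: AX=XA\ \ \forall X\in\mathcal C\},\qquad Z(\mathcal C)=\mathcal I_\ell(\mathcal C)\cap C(\mathcal C),$$ with $A$ ranging over $M_m(D)$. A code $\mathcal C'\subseteq M_m(D)$ is equivalent to $\mathcal C$ if $\mathcal C'=\{AX^{\theta}B: X\in\mathcal C\}$ for some $A,B\in GL_m(D)$ and $\theta\in\mathrm{Aut}(D)$, where $\theta$ is applied entrywise. For an automorphism $\tau$ of $L$ let $L_\tau=\{a\in L:a^{\tau}=a\}$, and let $K_\rho=K\cap L_\rho$. Exponents compose from left to right, so that $L_{\sigma^{sk}\rho^{-1}}=\{a: (a^{\sigma^{sk}})^{\rho^{-1}}=a\}$. **Theorem.** Assume that $k\le n/2$ and $sk>1$, and let $\mathcal C'$ be any code that is equivalent to $S_{n,s,k}(\eta,\rho,F)$ and contains the identity. Then, with $\cong$ denoting isomorphism of rings: * If $\eta\ne 0$, then $\mathcal I_\ell(\mathcal C')\cong L_\rho$, $\ \mathcal I_r(\mathcal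 C')\cong L_{\sigma^{sk}\rho^{-1}}$, $\ C(\mathcal C')\cong Z(R_F)$ and $Z(\mathcal C')\cong K_\rho$. * If $\eta=0$, then $S_{n,s,k}(0,\rho,F)=S_{n,s,k}(0,\rho',F)$ for every additive map $\rho':L\to L$ in place of $\rho$ (in particular for $\rho'=0$), and $\mathcal I_\ell(\mathcal C')\cong L$, $\ \mathcal I_r(\mathcal C')\cong L$, $\ C(\mathcal C')\cong Z(R_F)$ and $Z(\mathcal C')\cong K$. -/

import Mathlib

open Polynomial

noncomputable section

namespace SkewCode

section SkewRing

variable {K L : Type*} [Field K] [Field L] [Algebra K L]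

/-- The action of `ℕ` on `L` by the iterates of `σ`; this is how Mathlib's skew polynomials
are told about the twist. -/
@[reducible] def twist (σ : L ≃ₐ[K] L) : MulSemiringAction (Multiplicative ℕ) L :=
  MulSemiringAction.compHom L (powersHom (L ≃ₐ[K] L) σ)

/-- The skew polynomial ring `L[x; σ]`: polynomials with coefficients on the left, multiplied
by the rule `x a = σ(a) x`. -/
def SkewPoly (_σ : L ≃ₐ[K] L) := SkewPolynomial L

instance (σ : L ≃ₐ[K] L) : Ring (SkewPoly σ) :=
  letI := twist σ
  inferInstanceAs (Ring (SkewPolynomial L))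

variable (σ : L ≃ₐ[K] L)

/-- The skew polynomial `a x ^ i`. -/
def SkewPoly.monomial (i : ℕ) (a : L) : SkewPoly σ := SkewPolynomial.monomial i a

variable {σ}

/-- The (left) coefficient of `x ^ i`. -/
def SkewPoly.coeff (f : SkewPoly σ) (i : ℕ) : L := SkewPolynomial.coeff f i

theorem SkewPoly.monomial_mul_monomial (i j : ℕ) (a b : L) :
    SkewPoly.monomial σ i a * SkewPoly.monomial σ j b =
      SkewPoly.monomial σ (i + j) (a * (σ ^ i) b) := by
  let := twist σ
  have h := SkewPolynomial.monomial_mul_monomial i j a b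
  rw [SkewPolynomial.φ_iterate_apply] at h
  exact h

theorem SkewPoly.coeff_zero (i : ℕ) : (0 : SkewPoly σ).coeff i = 0 := rfl

theorem SkewPoly.coeff_add (f g : SkewPoly σ) (i : ℕ) :
    (f + g).coeff i = f.coeff i + g.coeff i := by
  let := twist σ
  exact SkewPolynomial.coeff_add f g i

theorem SkewPoly.coeff_neg (f : SkewPoly σ) (i : ℕ) : (-f).coeff i = -f.coeff i := by
  have h := SkewPoly.coeff_add f (-f) i
  rw [add_neg_cancel, SkewPoly.coeff_zero] at h
  exact eq_neg_of_add_eq_zero_right h.symm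

variable (σ)

/-- The skew polynomial `F(x ^ n)` for `F ∈ K[y]`, where `n = [L : K]`. -/
def centralPoly (F : K[X]) : SkewPoly σ :=
  F.sum fun i c => SkewPoly.monomial σ (Module.finrank K L * i) (algebraMap K L c)

variable {σ} [FiniteDimensional K L] [IsGalois K L]

theorem pow_finrank_mul (i : ℕ) : σ ^ (Module.finrank K L * i) = 1 := by
  rw [← IsGalois.card_aut_eq_finrank, pow_mul, pow_card_eq_one', one_pow]

theorem centralPoly_comm (F : K[X]) (f : SkewPoly σ) :
    f * centralPoly σ F = centralPoly σ F * f := by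
  have key : ∀ (j : ℕ) (b : L), SkewPoly.monomial σ j b * centralPoly σ F =
      centralPoly σ F * SkewPoly.monomial σ j b := by
    intro j b
    simp only [centralPoly, Polynomial.sum_def, Finset.mul_sum, Finset.sum_mul,
      SkewPoly.monomial_mul_monomial, pow_finrank_mul, AlgEquiv.one_apply, AlgEquiv.commutes]
    exact Finset.sum_congr rfl fun i _ => by rw [add_comm j, mul_comm b]
  refine SkewPolynomial.induction (motive := fun f : SkewPoly σ =>
    f * centralPoly σ F = centralPoly σ F * f) f ?_ ?_
  · exact (zero_mul (centralPoly σ F)).trans (mul_zero _).symm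
  · intro j b q _ _ hq
    have h1 := add_mul (SkewPoly.monomial σ j b) q (centralPoly σ F)
    have h2 := mul_add (centralPoly σ F) (SkewPoly.monomial σ j b) q
    rw [key j b, hq] at h1
    exact h1.trans h2.symm

instance centralIdeal_isTwoSided (F : K[X]) :
    (Ideal.span {centralPoly σ F} : Ideal (SkewPoly σ)).IsTwoSided := by
  refine ⟨fun {a} b ha => ?_⟩
  obtain ⟨c, rfl⟩ := Ideal.mem_span_singleton'.1 ha
  refine Ideal.mem_span_singleton'.2 ⟨c * b, ?_⟩
  rw [mul_assoc, mul_assoc, centralPoly_comm]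

variable (σ)

/-- The ring `R_F = R / R F(x ^ n)`, where `R = L[x; σ]` and `n = [L : K]`. -/
abbrev SkewQuot (F : K[X]) := SkewPoly σ ⧸ (Ideal.span {centralPoly σ F} : Ideal (SkewPoly σ))

/-- The code `S_{n,s,k}(η, ρ, F) = {a + R F(x ^ n) : deg a ≤ s k, a_{sk} = η a_0 ^ ρ}`, where
`s = deg F`. -/
def code (F : K[X]) (k : ℕ) (η : L) (ρ : L →+ L) : AddSubgroup (SkewQuot σ F) where
  carrier := {c | ∃ a : SkewPoly σ, (∀ i, F.natDegree * k < i → a.coeff i = 0) ∧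
    a.coeff (F.natDegree * k) = η * ρ (a.coeff 0) ∧ Ideal.Quotient.mk _ a = c}
  zero_mem' := ⟨0, fun _ _ => rfl, by simp [SkewPoly.coeff_zero], map_zero _⟩
  add_mem' := by
    rintro _ _ ⟨a, ha, ha', rfl⟩ ⟨b, hb, hb', rfl⟩
    refine ⟨a + b, fun i hi => ?_, ?_, map_add _ _ _⟩
    · rw [SkewPoly.coeff_add, ha i hi, hb i hi, add_zero]
    · rw [SkewPoly.coeff_add, SkewPoly.coeff_add, ha', hb', map_add, mul_add]
  neg_mem' := by
    rintro _ ⟨a, ha, ha', rfl⟩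
    refine ⟨-a, fun i hi => ?_, ?_, map_neg _ _⟩
    · rw [SkewPoly.coeff_neg, ha i hi, neg_zero]
    · rw [SkewPoly.coeff_neg, SkewPoly.coeff_neg, ha', map_neg, mul_neg]

/-- The subfield `L_τ` of elements fixed by the automorphism `τ` of `L`. -/
def fixedSubfield (τ : L ≃+* L) : Subfield L := RingHom.eqLocusField (τ : L →+* L) (RingHom.id L)

end SkewRing

section Codes

/-- Two additive codes of `m × m` matrices over `D` are equivalent if the second is
`{A X ^ θ B : X ∈ C}` for some invertible `A`, `B` and some automorphism `θ` of `D`, applied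
entrywise. -/
def Equivalent {D : Type*} [DivisionRing D] {m : ℕ}
    (C C' : AddSubgroup (Matrix (Fin m) (Fin m) D)) : Prop :=
  ∃ (A B : (Matrix (Fin m) (Fin m) D)ˣ) (θ : D ≃+* D),
    (C' : Set (Matrix (Fin m) (Fin m) D)) =
      {Y | ∃ X ∈ C, Y = (A : Matrix (Fin m) (Fin m) D) * X.map θ * B}

variable {M : Type*} [Ring M]

/-- `{A : A C ⊆ C}`. -/
def leftIdealiser (C : AddSubgroup M) : Subring M where
  carrier := {A | ∀ X ∈ C, A * X ∈ C}
  mul_mem' := fun {A B} hA hB X hX => by rw [mul_assoc]; exact hA _ (hB X hX)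
  one_mem' := fun X hX => by rwa [one_mul]
  add_mem' := fun {A B} hA hB X hX => by rw [add_mul]; exact C.add_mem (hA X hX) (hB X hX)
  zero_mem' := fun X _ => by rw [zero_mul]; exact C.zero_mem
  neg_mem' := fun {A} hA X hX => by rw [neg_mul]; exact C.neg_mem (hA X hX)

/-- `{A : C A ⊆ C}`. -/
def rightIdealiser (C : AddSubgroup M) : Subring M where
  carrier := {A | ∀ X ∈ C, X * A ∈ C}
  mul_mem' := fun {A B} hA hB X hX => by rw [← mul_assoc]; exact hB _ (hA X hX)
  one_mem' := fun X hX => by rwa [mul_one]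
  add_mem' := fun {A B} hA hB X hX => by rw [mul_add]; exact C.add_mem (hA X hX) (hB X hX)
  zero_mem' := fun X _ => by rw [mul_zero]; exact C.zero_mem
  neg_mem' := fun {A} hA X hX => by rw [mul_neg]; exact C.neg_mem (hA X hX)

/-- `{A : A X = X A for all X ∈ C}`. -/
def centraliser (C : AddSubgroup M) : Subring M := Subring.centralizer (C : Set M)

/-- The centre of a code: the intersection of its left idealiser and its centraliser. -/
def centre (C : AddSubgroup M) : Subring M := leftIdealiser C ⊓ centraliser C

end Codes

end SkewCode

end

/-! Write s = deg F. Equivalence turns a code S into A ψ(S) B for a ring isomorphism ψ from R_F to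
the matrix ring and units A, B. Then the left idealiser is conjugated by A, the right one by the
inverse of B, and a matrix commuting with A ψ(S) B yields c, d in R_F with cX = Xd on S. So
everything reduces to R_F.

Since F is monic, a class of R_F has at most one representative of degree below ns, and 2sk ≤ ns.
The code contains every a x^i with 0 < i < sk, in particular x. If A lies in the left idealiser, Ax
= b has a representative of degree at most sk; multiplying by β x^(sk-2) stays below degree ns, and
membership of the product in the code forces deg b ≤ 2. As F_0 ≠ 0, x is invertible, so A = b_0 x⁻¹
+ b_1 + b_2 x. The representative of x⁻¹ has degree ns - 1 > sk, which eliminates b_0 and b_2 except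
when η ≠ 0, sk = 2 and ns = 4; there b_0 satisfies a σ²-semilinear equation whose nonzero solutions
would give N(η) F_0^k = 1. Hence A is a constant, and testing it on 1 + η x^(sk) gives the fixed
field. The right idealiser is symmetric (`eq_const_of_mem_leftIdealiser`,
`eq_const_of_mem_rightIdealiser`).

For the centraliser, cX = Xd on S forces c = d central (`mem_center_of_intertwines`); again only sk
= 2 needs the norm condition. The centre of the code then consists of the central elements of the
left idealiser, which come from K. -/

noncomputable section

namespace SkewCode

set_option linter.unusedSectionVars false

/-! ### Coefficients in L[x; σ] and the central polynomials F(x^n). -/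

section

variable {K L : Type*} [Field K] [Field L] [Algebra K L] {σ : L ≃ₐ[K] L}

namespace SkewPoly

@[ext] theorem ext {f g : SkewPoly σ} (h : ∀ i, f.coeff i = g.coeff i) : f = g :=
  SkewPolynomial.ext h

theorem coeff_sub (f g : SkewPoly σ) (i : ℕ) : (f - g).coeff i = f.coeff i - g.coeff i := by
  rw [sub_eq_add_neg, coeff_add, coeff_neg, sub_eq_add_neg]

theorem coeff_monomial (i j : ℕ) (a : L) :
    (monomial σ i a).coeff j = if i = j then a else 0 :=
  SkewPolynomial.coeff_monomial

theorem monomial_add (i : ℕ) (a b : L) :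
    monomial σ i (a + b) = monomial σ i a + monomial σ i b := by
  ext j
  rw [coeff_add, coeff_monomial, coeff_monomial, coeff_monomial]
  split_ifs <;> simp

theorem monomial_zero_right (i : ℕ) : monomial σ i 0 = 0 := by
  ext j
  rw [coeff_monomial, coeff_zero, ite_self]

theorem one_eq_monomial : (1 : SkewPoly σ) = monomial σ 0 1 := rfl

/-- The constants, as a ring homomorphism. -/
def C (σ : L ≃ₐ[K] L) : L →+* SkewPoly σ where
  toFun := monomial σ 0
  map_one' := rfl
  map_mul' a b := by rw [monomial_mul_monomial]; simp
  map_zero' := monomial_zero_right 0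
  map_add' := monomial_add 0

theorem C_apply (a : L) : C σ a = monomial σ 0 a := rfl

/-- The coefficient of `x ^ i`, as an additive homomorphism. -/
def coeffHom (σ : L ≃ₐ[K] L) (i : ℕ) : SkewPoly σ →+ L where
  toFun f := f.coeff i
  map_zero' := coeff_zero i
  map_add' f g := coeff_add f g i

theorem coeff_sum {ι : Type*} (t : Finset ι) (f : ι → SkewPoly σ) (i : ℕ) :
    (∑ j ∈ t, f j).coeff i = ∑ j ∈ t, (f j).coeff i :=
  map_sum (coeffHom σ i) f t

theorem induction_on {P : SkewPoly σ → Prop} (f : SkewPoly σ) (h0 : P 0)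
    (h : ∀ i a g, P g → P (monomial σ i a + g)) : P f :=
  SkewPolynomial.induction (motive := P) f h0 fun i a g _ _ hg => h i a g hg

theorem coeff_mul_monomial (f : SkewPoly σ) (j : ℕ) (b : L) (i : ℕ) :
    (f * monomial σ j b).coeff i =
      if j ≤ i then f.coeff (i - j) * (σ ^ (i - j)) b else 0 := by
  induction f using induction_on with
  | h0 => simp [coeff_zero]
  | h l a g hg =>
    rw [add_mul, coeff_add, hg, monomial_mul_monomial, coeff_monomial, coeff_add, coeff_monomial]
    by_cases hj : j ≤ i
    · by_cases hl : l = i - j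
      · subst hl
        rw [if_pos (by omega), if_pos hj, if_pos hj, if_pos rfl, add_mul]
      · rw [if_neg (by omega), if_pos hj, if_pos hj, if_neg hl, zero_add, zero_add]
    · rw [if_neg (by omega), if_neg hj, if_neg hj, add_zero]

theorem coeff_monomial_mul (f : SkewPoly σ) (j : ℕ) (b : L) (i : ℕ) :
    (monomial σ j b * f).coeff i =
      if j ≤ i then b * (σ ^ j) (f.coeff (i - j)) else 0 := by
  induction f using induction_on with
  | h0 => simp [coeff_zero]
  | h l a g hg =>
    rw [mul_add, coeff_add, hg, monomial_mul_monomial, coeff_monomial, coeff_add, coeff_monomial]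
    by_cases hj : j ≤ i
    · by_cases hl : l = i - j
      · subst hl
        rw [if_pos (by omega), if_pos hj, if_pos hj, if_pos rfl, map_add, mul_add]
      · rw [if_neg (by omega), if_pos hj, if_pos hj, if_neg hl, zero_add, zero_add]
    · rw [if_neg (by omega), if_neg hj, if_neg hj, add_zero]

theorem coeff_C (a : L) (i : ℕ) : (C σ a).coeff i = if 0 = i then a else 0 :=
  coeff_monomial 0 i a

theorem coeff_C_mul (a : L) (f : SkewPoly σ) (i : ℕ) : (C σ a * f).coeff i = a * f.coeff i := by
  rw [C_apply, coeff_monomial_mul, if_pos (Nat.zero_le i), Nat.sub_zero, pow_zero,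
    AlgEquiv.one_apply]

theorem coeff_mul_C (a : L) (f : SkewPoly σ) (i : ℕ) :
    (f * C σ a).coeff i = f.coeff i * (σ ^ i) a := by
  rw [C_apply, coeff_mul_monomial, if_pos (Nat.zero_le i), Nat.sub_zero]

theorem exists_leadingCoeff {f : SkewPoly σ} (hf : f ≠ 0) :
    ∃ d, f.coeff d ≠ 0 ∧ ∀ i, d < i → f.coeff i = 0 := by
  have hb : ∃ N, ∀ i, N < i → f.coeff i = 0 := by
    clear hf
    induction f using induction_on with
    | h0 => exact ⟨0, fun i _ => coeff_zero i⟩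
    | h l a g hg =>
      obtain ⟨N, hN⟩ := hg
      refine ⟨max l N, fun i hi => ?_⟩
      rw [coeff_add, hN i (by omega), coeff_monomial, if_neg (by omega), add_zero]
  classical
  refine ⟨Nat.find hb, fun h0 => ?_, Nat.find_spec hb⟩
  rcases hd : Nat.find hb with _ | d
  · refine hf (ext fun i => ?_)
    rw [coeff_zero]
    rcases Nat.eq_zero_or_pos i with rfl | hi
    · rwa [hd] at h0
    · exact Nat.find_spec hb i (by omega)
  · refine Nat.find_min hb (m := d) (by omega) fun i hi => ?_
    rcases Nat.eq_or_lt_of_le (Nat.succ_le_of_lt hi) with rfl | hi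
    · rwa [hd] at h0
    · exact Nat.find_spec hb i (by omega)

theorem coeff_centralPoly [FiniteDimensional K L] (G : K[X]) (i : ℕ) :
    (centralPoly σ G).coeff i = if Module.finrank K L ∣ i then
      algebraMap K L (G.coeff (i / Module.finrank K L)) else 0 := by
  have hn : 0 < Module.finrank K L := Module.finrank_pos
  rw [centralPoly, Polynomial.sum_def, coeff_sum]
  simp only [coeff_monomial]
  split_ifs with h
  · obtain ⟨j, rfl⟩ := h
    rw [Nat.mul_div_cancel_left _ hn, Finset.sum_eq_single j]
    · rw [if_pos rfl]
    · intro l _ hl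
      rw [if_neg fun h => hl (Nat.eq_of_mul_eq_mul_left hn h)]
    · intro hj
      rw [if_pos rfl, notMem_support_iff.1 hj, map_zero]
  · exact Finset.sum_eq_zero fun l _ => if_neg fun hl => h ⟨l, hl.symm⟩

section Galois

variable [FiniteDimensional K L] [IsGalois K L]

/-- `F ↦ F(x ^ n)` as a ring homomorphism. -/
def centralHom (σ : L ≃ₐ[K] L) : K[X] →+* SkewPoly σ where
  toFun := centralPoly σ
  map_zero' := by simp [centralPoly]
  map_one' := by
    ext i
    rw [coeff_centralPoly, one_eq_monomial, coeff_monomial]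
    have hn : 0 < Module.finrank K L := Module.finrank_pos
    rcases Nat.eq_zero_or_pos i with rfl | hi
    · simp
    · rw [if_neg hi.ne]
      split_ifs with h
      · rw [Polynomial.coeff_one, if_neg, map_zero]
        exact (Nat.div_pos (Nat.le_of_dvd hi h) hn).ne'
      · rfl
  map_add' F G := by
    ext i
    rw [coeff_add, coeff_centralPoly, coeff_centralPoly, coeff_centralPoly]
    split_ifs <;> simp
  map_mul' F G := by
    have hadd : ∀ F G : K[X], centralPoly σ (F + G) = centralPoly σ F + centralPoly σ G := by
      intro F G
      ext i
      rw [coeff_add, coeff_centralPoly, coeff_centralPoly, coeff_centralPoly]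
      split_ifs <;> simp
    have hmon : ∀ i a, centralPoly σ (Polynomial.monomial i a) =
        monomial σ (Module.finrank K L * i) (algebraMap K L a) := fun i a =>
      Polynomial.sum_monomial_index _ _ (by rw [map_zero, monomial_zero_right])
    induction F using Polynomial.induction_on' with
    | add p q hp hq => rw [add_mul, hadd, hp, hq, hadd, add_mul]
    | monomial i a =>
      induction G using Polynomial.induction_on' with
      | add p q hp hq => rw [mul_add, hadd, hp, hq, hadd, mul_add]
      | monomial j b =>
        rw [Polynomial.monomial_mul_monomial, hmon, hmon, hmon,
          SkewPoly.monomial_mul_monomial, pow_finrank_mul, AlgEquiv.one_apply, mul_add, map_mul]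

theorem centralHom_apply (G : K[X]) : centralHom σ G = centralPoly σ G := rfl

theorem centralHom_C (a : K) : centralHom σ (Polynomial.C a) = C σ (algebraMap K L a) := by
  rw [centralHom_apply, centralPoly, Polynomial.sum_C_index (by rw [map_zero, monomial_zero_right]),
    mul_zero, C_apply]

theorem centralHom_X :
    centralHom σ (Polynomial.X : K[X]) = monomial σ (Module.finrank K L) 1 := by
  rw [centralHom_apply, centralPoly, Polynomial.sum_X_index (by rw [map_zero, monomial_zero_right]),
    mul_one, map_one]

/-- As F is monic, g F(x^n) has the leading coefficient of g, shifted by ns. This makes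
representatives of degree below ns unique. -/
theorem eq_zero_of_mem_span {F : K[X]} (hF : F.Monic) {p : SkewPoly σ}
    (hp : p ∈ (Ideal.span {centralPoly σ F} : Ideal (SkewPoly σ)))
    (h : ∀ i, Module.finrank K L * F.natDegree ≤ i → p.coeff i = 0) : p = 0 := by
  obtain ⟨g, rfl⟩ := Ideal.mem_span_singleton'.1 hp
  by_contra hne
  have hg : g ≠ 0 := by rintro rfl; exact hne (zero_mul _)
  obtain ⟨d, hd, hd'⟩ := exists_leadingCoeff hg
  apply hd
  have hn : 0 < Module.finrank K L := Module.finrank_pos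
  have := h (d + Module.finrank K L * F.natDegree) (Nat.le_add_left _ _)
  rw [centralPoly, Polynomial.sum_def, Finset.mul_sum, coeff_sum,
    Finset.sum_eq_single F.natDegree] at this
  · rw [coeff_mul_monomial, if_pos (Nat.le_add_left _ _), Nat.add_sub_cancel,
      coeff_natDegree, hF.leadingCoeff] at this
    simpa using this
  · intro j hj hjF
    have hlt : j < F.natDegree := lt_of_le_of_ne (le_natDegree_of_mem_supp j hj) hjF
    have hmul := Nat.mul_lt_mul_of_pos_left hlt hn
    rw [coeff_mul_monomial, if_pos (by omega), hd' _ (by omega), zero_mul]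
  · intro hF'
    rw [Polynomial.notMem_support_iff.1 hF', map_zero, monomial_zero_right, mul_zero, coeff_zero]

end Galois

end SkewPoly

end

/-! ### The quotient R_F, the inverse of x, and membership in the code. -/

section

variable {K L : Type*} [Field K] [Field L] [Algebra K L] {σ : L ≃ₐ[K] L}
  [FiniteDimensional K L] [IsGalois K L] {F : K[X]}

namespace SkewPoly

/-- The projection of `L[x; σ]` onto `R_F`. -/
abbrev toQuot (σ : L ≃ₐ[K] L) (F : K[X]) : SkewPoly σ →+* SkewQuot σ F :=
  Ideal.Quotient.mk _

theorem toQuot_surjective : Function.Surjective (toQuot σ F) :=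
  Ideal.Quotient.mk_surjective

/-- The constants of `R_F`. -/
def const (σ : L ≃ₐ[K] L) (F : K[X]) : L →+* SkewQuot σ F := (toQuot σ F).comp (C σ)

/-- The class of `x` in `R_F`. -/
def root (σ : L ≃ₐ[K] L) (F : K[X]) : SkewQuot σ F := toQuot σ F (monomial σ 1 1)

theorem toQuot_C (a : L) : toQuot σ F (C σ a) = const σ F a := rfl

theorem monomial_eq (i : ℕ) (a : L) : monomial σ i a = C σ a * monomial σ 1 1 ^ i := by
  induction i with
  | zero => rw [pow_zero, mul_one, C_apply]
  | succ i ih => rw [pow_succ, ← mul_assoc, ← ih, monomial_mul_monomial, map_one, mul_one]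

theorem toQuot_monomial (i : ℕ) (a : L) :
    toQuot σ F (monomial σ i a) = const σ F a * root σ F ^ i := by
  rw [monomial_eq, map_mul, map_pow, toQuot_C, root]

theorem root_mul_const (a : L) : root σ F * const σ F a = const σ F (σ a) * root σ F := by
  rw [root, ← toQuot_C, ← toQuot_C, ← map_mul, ← map_mul, C_apply, C_apply,
    monomial_mul_monomial, monomial_mul_monomial]
  simp

theorem toQuot_centralHom_self : toQuot σ F (centralHom σ F) = 0 :=
  Ideal.Quotient.eq_zero_iff_mem.2 (Ideal.mem_span_singleton_self _)

/-- A Bézout relation uF + vP = 1 in K[y] maps to an inverse of P, because F(x^n) vanishes in R_F.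
-/
theorem isUnit_toQuot_centralHom (hF : Irreducible F) {P : K[X]} (hP : ¬ F ∣ P) :
    IsUnit (toQuot σ F (centralHom σ P)) := by
  obtain ⟨u, v, h⟩ := (hF.coprime_iff_not_dvd).2 hP
  have h' := congrArg (fun q => toQuot σ F (centralHom σ q)) h
  simp only [map_add, map_mul, toQuot_centralHom_self, mul_zero, zero_add, map_one] at h'
  have hc : Commute (toQuot σ F (centralHom σ v)) (toQuot σ F (centralHom σ P)) := by
    rw [Commute, SemiconjBy, ← map_mul, ← map_mul, ← map_mul, ← map_mul, mul_comm v]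
  exact isUnit_iff_exists.2 ⟨_, hc.eq ▸ h', h'⟩

theorem central_mul_comm (P : K[X]) (c : SkewQuot σ F) :
    c * toQuot σ F (centralHom σ P) = toQuot σ F (centralHom σ P) * c := by
  obtain ⟨f, rfl⟩ := toQuot_surjective c
  rw [← map_mul, ← map_mul, centralHom_apply, centralPoly_comm]

theorem root_pow_finrank :
    root σ F ^ Module.finrank K L = toQuot σ F (centralHom σ (Polynomial.X : K[X])) := by
  rw [centralHom_X, toQuot_monomial, map_one, one_mul]

theorem const_algebraMap (a : K) :
    const σ F (algebraMap K L a) = toQuot σ F (centralHom σ (Polynomial.C a)) := by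
  rw [centralHom_C, toQuot_C]

theorem mem_center_of_commutes {c : SkewQuot σ F} (h : ∀ a, c * const σ F a = const σ F a * c)
    (hx : c * root σ F = root σ F * c) : c ∈ Subring.center (SkewQuot σ F) := by
  refine Subring.mem_center_iff.2 fun g => ?_
  obtain ⟨f, rfl⟩ := toQuot_surjective g
  induction f using induction_on with
  | h0 => rw [map_zero, zero_mul, mul_zero]
  | h i a g hg =>
    rw [map_add, add_mul, mul_add, hg, toQuot_monomial]
    have hc : Commute c (const σ F a * root σ F ^ i) :=
      Commute.mul_right (h a) (Commute.pow_right hx i)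
    rw [hc.eq]

theorem nontrivial_skewQuot (hF : F.Monic) (hF' : Irreducible F) : Nontrivial (SkewQuot σ F) := by
  refine Ideal.Quotient.nontrivial_iff.2 fun h => ?_
  have h1 : (1 : SkewPoly σ) ∈ (Ideal.span {centralPoly σ F} : Ideal (SkewPoly σ)) := by
    rw [h]; trivial
  have hpos : 0 < Module.finrank K L * F.natDegree :=
    Nat.mul_pos Module.finrank_pos hF'.natDegree_pos
  have := congrArg (fun f => coeff f 0) (eq_zero_of_mem_span hF h1 fun i hi => by
    rw [one_eq_monomial, coeff_monomial, if_neg (by omega)])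
  simp only [one_eq_monomial, coeff_monomial, coeff_zero, if_true] at this
  exact one_ne_zero this

/-- A skew polynomial that represents the inverse of `x` in `R_F`. -/
def invX (σ : L ≃ₐ[K] L) (F : K[X]) : SkewPoly σ :=
  monomial σ (Module.finrank K L - 1) (algebraMap K L (-(F.coeff 0)⁻¹)) * centralPoly σ F.divX

/-- With F = F_0 + yG, the polynomial -F_0⁻¹ y G equals 1 - F_0⁻¹ F, hence is 1 modulo F. Splitting
one x off y = x^n then gives x⁻¹. -/
theorem monomial_finrank_mul_divX (h0 : F.coeff 0 ≠ 0) :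
    toQuot σ F (monomial σ (Module.finrank K L) (algebraMap K L (-(F.coeff 0)⁻¹)) *
      centralPoly σ F.divX) = 1 := by
  have h1 : monomial σ (Module.finrank K L) (algebraMap K L (-(F.coeff 0)⁻¹)) *
      centralPoly σ F.divX =
      centralHom σ (1 - Polynomial.C (F.coeff 0)⁻¹ * F) := by
    have h2 : (1 - Polynomial.C (F.coeff 0)⁻¹ * F) =
        Polynomial.C (-(F.coeff 0)⁻¹) * Polynomial.X * F.divX := by
      conv_lhs => rw [← F.divX_mul_X_add]
      rw [mul_add, ← Polynomial.C_mul, Polynomial.coeff_add, Polynomial.coeff_mul_X_zero,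
        Polynomial.coeff_C_zero, zero_add, inv_mul_cancel₀ h0, Polynomial.C_neg, Polynomial.C_1]
      ring
    rw [h2, map_mul, map_mul, centralHom_C, centralHom_X, centralHom_apply, C_apply,
      monomial_mul_monomial]
    simp
  rw [h1, map_sub, map_one, map_sub, map_one, map_mul, map_mul, toQuot_centralHom_self, mul_zero,
    sub_zero]

theorem toQuot_invX_mul_root (h0 : F.coeff 0 ≠ 0) : toQuot σ F (invX σ F) * root σ F = 1 := by
  have hn : 0 < Module.finrank K L := Module.finrank_pos
  rw [root, ← map_mul, invX, mul_assoc, ← centralPoly_comm, ← mul_assoc, monomial_mul_monomial,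
    Nat.sub_add_cancel hn, map_one, mul_one, monomial_finrank_mul_divX h0]

theorem root_mul_toQuot_invX (h0 : F.coeff 0 ≠ 0) : root σ F * toQuot σ F (invX σ F) = 1 := by
  have hn : 0 < Module.finrank K L := Module.finrank_pos
  rw [root, ← map_mul, invX, ← mul_assoc, monomial_mul_monomial,
    Nat.add_sub_cancel' hn, one_mul, AlgEquiv.commutes, monomial_finrank_mul_divX h0]

/-- This nonzero coefficient sits in degree ns - 1, above sk, so it detects any multiple of x⁻¹ in
an element of the code. -/
theorem coeff_invX_top (hF : F.Monic) (hs : 0 < F.natDegree) :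
    (invX σ F).coeff (Module.finrank K L * F.natDegree - 1) =
      algebraMap K L (-(F.coeff 0)⁻¹) := by
  have hn : 0 < Module.finrank K L := Module.finrank_pos
  obtain ⟨t, ht⟩ : ∃ t, F.natDegree = t + 1 := ⟨F.natDegree - 1, by omega⟩
  have h1 : Module.finrank K L * F.natDegree - 1 =
      Module.finrank K L - 1 + Module.finrank K L * t := by rw [ht, mul_add]; omega
  rw [invX, coeff_monomial_mul, h1, if_pos (Nat.le_add_right _ _), Nat.add_sub_cancel_left,
    coeff_centralPoly, if_pos (dvd_mul_right _ _), Nat.mul_div_cancel_left _ hn,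
    Polynomial.coeff_divX, ← ht, Polynomial.coeff_natDegree, hF.leadingCoeff, map_one, map_one,
    mul_one]

theorem coeff_invX_of_le {i : ℕ} (hi : Module.finrank K L * F.natDegree ≤ i) :
    (invX σ F).coeff i = 0 := by
  have hn : 0 < Module.finrank K L := Module.finrank_pos
  rw [invX, coeff_monomial_mul]
  split_ifs with h
  · rw [coeff_centralPoly]
    split_ifs with hd
    · obtain ⟨j, hj⟩ := hd
      have hlt : F.natDegree < j + 1 := by
        refine Nat.lt_of_mul_lt_mul_left (a := Module.finrank K L) ?_
        rw [mul_add]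
        omega
      rw [hj, Nat.mul_div_cancel_left _ hn, Polynomial.coeff_divX,
        Polynomial.coeff_eq_zero_of_natDegree_lt hlt, map_zero, map_zero, mul_zero]
    · rw [map_zero, mul_zero]
  · rfl

variable (σ F) in
/-- The class of `x` as a unit of `R_F`. -/
def rootUnit (h0 : F.coeff 0 ≠ 0) : (SkewQuot σ F)ˣ :=
  ⟨root σ F, toQuot σ F (invX σ F), root_mul_toQuot_invX h0, toQuot_invX_mul_root h0⟩

theorem isUnit_root (h0 : F.coeff 0 ≠ 0) : IsUnit (root σ F) := ⟨rootUnit σ F h0, rfl⟩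

/-- Uniqueness of the representative below degree ns turns membership of a class into conditions on
the coefficients of p itself. -/
theorem toQuot_mem_code_iff (hF : F.Monic) {k : ℕ} {η : L} {ρ : L →+ L}
    (hk : F.natDegree * k < Module.finrank K L * F.natDegree) {p : SkewPoly σ}
    (hp : ∀ i, Module.finrank K L * F.natDegree ≤ i → p.coeff i = 0) :
    toQuot σ F p ∈ code σ F k η ρ ↔ (∀ i, F.natDegree * k < i → p.coeff i = 0) ∧
      p.coeff (F.natDegree * k) = η * ρ (p.coeff 0) := by
  constructor
  · rintro ⟨a, ha, ha', hap⟩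
    have : a - p = 0 := eq_zero_of_mem_span hF (Ideal.Quotient.eq.1 hap) fun i hi => by
      rw [coeff_sub, hp i hi, ha i (by omega), sub_zero]
    rw [← sub_eq_zero.1 this]
    exact ⟨ha, ha'⟩
  · rintro ⟨h, h'⟩
    exact ⟨p, h, h', rfl⟩

theorem toQuot_monomial_mem_code {k : ℕ} {η : L} {ρ : L →+ L} {i : ℕ} (hi : 0 < i)
    (hik : i < F.natDegree * k) (a : L) : toQuot σ F (monomial σ i a) ∈ code σ F k η ρ := by
  refine ⟨_, fun j hj => ?_, ?_, rfl⟩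
  · rw [coeff_monomial, if_neg (by omega)]
  · rw [coeff_monomial, coeff_monomial, if_neg (by omega), if_neg (by omega), map_zero, mul_zero]

theorem toQuot_C_add_monomial_mem_code {k : ℕ} {η : L} {ρ : L →+ L} (hk : 0 < F.natDegree * k)
    (a : L) : toQuot σ F (C σ a + monomial σ (F.natDegree * k) (η * ρ a)) ∈ code σ F k η ρ := by
  refine ⟨_, fun j hj => ?_, ?_, rfl⟩
  · rw [coeff_add, C_apply, coeff_monomial, coeff_monomial, if_neg (by omega), if_neg (by omega),
      add_zero]
  · rw [coeff_add, coeff_add, C_apply, coeff_monomial, coeff_monomial, coeff_monomial,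
      coeff_monomial, if_neg (by omega), if_pos rfl, if_pos rfl, if_neg (by omega), zero_add,
      add_zero]

end SkewPoly

/-! ### Norms for a cyclic extension and the exceptional equation. -/

theorem algebraMap_norm_eq_prod_range (hσ : ∀ τ : L ≃ₐ[K] L, τ ∈ Subgroup.zpowers σ) (a : L) :
    algebraMap K L (Algebra.norm K a) =
      ∏ i ∈ Finset.range (Module.finrank K L), (σ ^ i) a := by
  classical
  rw [Algebra.norm_eq_prod_automorphisms, ← IsGalois.card_aut_eq_finrank,
    ← IsCyclic.image_range_card hσ, Finset.prod_image]
  intro i hi j hj hij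
  have ho : orderOf σ = Nat.card (L ≃ₐ[K] L) := orderOf_eq_card_of_forall_mem_zpowers hσ
  rw [← ho] at hi hj
  simp only [Finset.coe_range, Set.mem_Iio] at hi hj
  exact pow_injOn_Iio_orderOf hi hj hij

/-- Disposes of the case sk = 2, ns = 4: going once around the Galois group with the equation gives
c = N(η) F_0^k c. -/
theorem eq_zero_of_eq_mul_apply_sq (hσ : ∀ τ : L ≃ₐ[K] L, τ ∈ Subgroup.zpowers σ) {k : ℕ}
    (hk : F.natDegree * k = 2) (hn : Module.finrank K L * F.natDegree = 4) {η c : L}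
    (hη : Algebra.norm K η * F.coeff 0 ^ k ≠ 1)
    (hc : c = algebraMap K L (F.coeff 0) * (η * σ η) * σ (σ c)) : c = 0 := by
  by_contra hc0
  apply hη
  apply (algebraMap K L).injective
  rw [map_mul, algebraMap_norm_eq_prod_range hσ, map_pow, map_one]
  apply mul_right_cancel₀ hc0
  have hs : F.natDegree ∣ 2 := ⟨k, hk.symm⟩
  have hs' := (Nat.dvd_prime Nat.prime_two).1 hs
  have hpow : ∀ a, (σ ^ Module.finrank K L) a = a := fun a => by
    rw [← IsGalois.card_aut_eq_finrank, pow_card_eq_one', AlgEquiv.one_apply]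
  -- If s = 1 then k = 2 and n = 4, so the equation is applied twice; if s = 2 then k = 1 and n = 2,
  -- and σ² = 1 makes one application enough.
  rcases hs' with h | h
  · have h4 : Module.finrank K L = 4 := by rw [h] at hn; omega
    have h2 : k = 2 := by rw [h] at hk; omega
    have hc2 := congrArg (fun z => σ (σ z)) hc
    simp only [map_mul, AlgEquiv.commutes] at hc2
    have h4' := hpow c
    rw [h4] at h4' ⊢
    simp only [pow_succ, pow_zero, one_mul, AlgEquiv.mul_apply, Finset.prod_range_succ,
      Finset.prod_range_zero, AlgEquiv.one_apply, h2] at h4' ⊢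
    rw [h4'] at hc2
    rw [hc2] at hc
    linear_combination -hc
  · have h4 : Module.finrank K L = 2 := by rw [h] at hn; omega
    have h2 : k = 1 := by rw [h] at hk; omega
    have h4' := hpow c
    rw [h4] at h4' ⊢
    simp only [pow_succ, pow_zero, one_mul, AlgEquiv.mul_apply, Finset.prod_range_succ,
      Finset.prod_range_zero, AlgEquiv.one_apply, h2] at h4' ⊢
    rw [h4'] at hc
    linear_combination -hc

end

/-! ### Idealisers of the code consist of constants. -/

section

variable {K L : Type*} [Field K] [Field L] [Algebra K L] {σ : L ≃ₐ[K] L}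
  [FiniteDimensional K L] [IsGalois K L] {F : K[X]}

namespace SkewPoly

theorem eq_const_of_mem_leftIdealiser (hσ : ∀ τ : L ≃ₐ[K] L, τ ∈ Subgroup.zpowers σ)
    (hF : F.Monic) (hF0 : F.coeff 0 ≠ 0) {k : ℕ} (hk : 2 * k ≤ Module.finrank K L)
    (hsk : 1 < F.natDegree * k) {η : L}
    (hη : F.natDegree * k = 2 → Algebra.norm K η * F.coeff 0 ^ k ≠ 1) (ρ : L ≃+* L)
    {A : SkewQuot σ F} (hA : A ∈ leftIdealiser (code σ F k η (ρ : L →+ L))) :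
    ∃ b, A = const σ F b := by
  have hs : 0 < F.natDegree := Nat.pos_of_ne_zero fun h => by rw [h] at hsk; omega
  have hns : 2 * (F.natDegree * k) ≤ Module.finrank K L * F.natDegree := by
    calc 2 * (F.natDegree * k) = 2 * k * F.natDegree := by ring
      _ ≤ _ := Nat.mul_le_mul_right _ hk
  have hlt : F.natDegree * k < Module.finrank K L * F.natDegree := by omega
  obtain ⟨b, hb, hb', hAb⟩ := hA _ (toQuot_monomial_mem_code one_pos hsk 1)
  change toQuot σ F b = A * root σ F at hAb
  -- A σ(β) x^(sk-1) = (Ax) β x^(sk-2), and b β x^(sk-2) has degree at most 2sk - 2 < ns, so its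
  -- coefficients can be read off.
  have key : ∀ β, (∀ i, F.natDegree * k < i →
        (b * monomial σ (F.natDegree * k - 2) β).coeff i = 0) ∧
      (b * monomial σ (F.natDegree * k - 2) β).coeff (F.natDegree * k) =
        η * ρ ((b * monomial σ (F.natDegree * k - 2) β).coeff 0) := by
    intro β
    refine (toQuot_mem_code_iff (ρ := (ρ : L →+ L)) hF hlt fun i hi => ?_).1 ?_
    · rw [coeff_mul_monomial, hb _ (by omega), zero_mul, ite_self]
    · have h1 : monomial σ (F.natDegree * k - 1) (σ β) =
          monomial σ 1 1 * monomial σ (F.natDegree * k - 2) β := by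
        rw [monomial_mul_monomial, one_mul, pow_one]
        congr 1
        omega
      have h2 := hA _ (toQuot_monomial_mem_code (i := F.natDegree * k - 1) (by omega) (by omega)
        (σ β))
      rwa [h1, map_mul, ← mul_assoc, ← root, ← hAb, ← map_mul] at h2
  have h3 : ∀ i, 3 ≤ i → b.coeff i = 0 := by
    intro i hi
    have := (key 1).1 (i + (F.natDegree * k - 2)) (by omega)
    rwa [coeff_mul_monomial, if_pos (by omega), Nat.add_sub_cancel, map_one, mul_one] at this
  have h2 : ∀ β, b.coeff 2 * σ (σ β) =
      η * ρ (if F.natDegree * k = 2 then b.coeff 0 * β else 0) := by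
    intro β
    have := (key β).2
    rw [coeff_mul_monomial, if_pos (by omega), coeff_mul_monomial,
      show F.natDegree * k - (F.natDegree * k - 2) = 2 by omega] at this
    rw [show σ (σ β) = (σ ^ 2) β from rfl, this]
    congr 2
    by_cases h : F.natDegree * k = 2
    · rw [if_pos (by omega), if_pos h, Nat.zero_sub, pow_zero, AlgEquiv.one_apply]
    · rw [if_neg (by omega), if_neg h]
  have hbx : b = (C σ (b.coeff 0) + monomial σ 1 (b.coeff 1) + monomial σ 2 (b.coeff 2)) := by
    ext i
    rw [coeff_add, coeff_add, C_apply, coeff_monomial, coeff_monomial, coeff_monomial]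
    rcases i with _ | _ | _ | i
    · simp
    · simp
    · simp
    · rw [h3 _ (by omega), if_neg (by omega), if_neg (by omega), if_neg (by omega)]
      simp
  have hAp : A = toQuot σ F (C σ (b.coeff 0) * invX σ F + C σ (b.coeff 1) +
      monomial σ 1 (b.coeff 2)) := by
    apply (isUnit_root hF0).mul_right_cancel
    rw [← hAb]
    conv_lhs => rw [hbx]
    rw [map_add, map_add, map_add, map_add, add_mul, add_mul, map_mul, mul_assoc,
      toQuot_invX_mul_root hF0, mul_one, toQuot_monomial, toQuot_monomial, toQuot_monomial,
      pow_one, toQuot_C, toQuot_C, mul_assoc, ← pow_two]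
  have hp : ∀ i, Module.finrank K L * F.natDegree ≤ i → (C σ (b.coeff 0) * invX σ F +
      C σ (b.coeff 1) + monomial σ 1 (b.coeff 2)).coeff i = 0 := by
    intro i hi
    rw [coeff_add, coeff_add, coeff_C_mul, coeff_C, coeff_monomial, coeff_invX_of_le hi,
      if_neg (by omega), if_neg (by omega), mul_zero, add_zero, add_zero]
  have htop : (C σ (b.coeff 0) * invX σ F + C σ (b.coeff 1) + monomial σ 1 (b.coeff 2)).coeff
      (Module.finrank K L * F.natDegree - 1) =
        b.coeff 0 * algebraMap K L (-(F.coeff 0)⁻¹) := by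
    rw [coeff_add, coeff_add, coeff_C_mul, coeff_C, coeff_monomial, coeff_invX_top hF hs,
      if_neg (by omega), if_neg (by omega), add_zero, add_zero]
  have hc0 : algebraMap K L (-(F.coeff 0)⁻¹) ≠ 0 := by
    rw [Ne, map_eq_zero, neg_eq_zero, inv_eq_zero]
    exact hF0
  -- It remains to remove the x⁻¹ and x terms from A = b_0 x⁻¹ + b_1 + b_2 x.
  suffices h : b.coeff 0 = 0 ∧ b.coeff 2 = 0 by
    refine ⟨b.coeff 1, ?_⟩
    rw [hAp, h.1, h.2, map_zero, zero_mul, zero_add, monomial_zero_right, add_zero, toQuot_C]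
  by_cases hη0 : η = 0
  · have hb2 : b.coeff 2 = 0 := by simpa [hη0] using h2 1
    refine ⟨?_, hb2⟩
    have h1 := hA _ (toQuot_C_add_monomial_mem_code (by omega) 1)
    rw [hη0, zero_mul, monomial_zero_right, add_zero, map_one, map_one, mul_one, hAp,
      toQuot_mem_code_iff hF hlt hp] at h1
    have h4 := h1.1 _ (show _ < Module.finrank K L * F.natDegree - 1 by omega)
    rw [htop] at h4
    exact (mul_eq_zero.1 h4).resolve_right hc0
  · by_cases hsk2 : F.natDegree * k = 2
    · have hb2 : b.coeff 2 = η * ρ (b.coeff 0) := by simpa [hsk2] using h2 1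
      suffices hb0 : b.coeff 0 = 0 from ⟨hb0, by rw [hb2, hb0, map_zero, mul_zero]⟩
      by_contra hb0
      -- For sk = 2 the relation b_2 σ²(β) = η ρ(b_0 β) holds for all β; with b_0 ≠ 0 it determines
      -- ρ.
      have hρ : ∀ β, ρ β = σ (σ β) := by
        intro β
        have h4 := h2 β
        rw [if_pos hsk2, hb2, map_mul, ← mul_assoc] at h4
        exact (mul_left_cancel₀ (mul_ne_zero hη0 fun h => hb0 (by simpa using h)) h4).symm
      have h1 := hA _ (toQuot_C_add_monomial_mem_code (by omega) 1)
      have h5 : monomial σ 2 η = monomial σ 1 1 * monomial σ 1 (σ.symm η) := by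
        rw [monomial_mul_monomial, one_mul, pow_one, σ.apply_symm_apply]
      have h6 : ((ρ : L →+ L) 1 : L) = 1 := map_one ρ
      rw [h6, mul_one, map_one, hsk2, h5, map_add, map_one, mul_add, mul_one, map_mul,
        ← mul_assoc, ← root, ← hAb, hAp, ← map_mul, ← map_add, toQuot_mem_code_iff hF hlt] at h1
      · have h4 := h1.1 (Module.finrank K L * F.natDegree - 1) (by omega)
        rw [coeff_add, htop, coeff_mul_monomial, if_pos (by omega)] at h4
        by_cases hn4 : Module.finrank K L * F.natDegree = 4
        · apply hb0
          refine eq_zero_of_eq_mul_apply_sq hσ hsk2 hn4 (hη hsk2) ?_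
          rw [hn4, show 4 - 1 - 1 = 2 from rfl, show (σ ^ 2) (σ.symm η) = σ (σ (σ.symm η)) from rfl,
            σ.apply_symm_apply, hb2, hρ, map_neg, map_inv₀] at h4
          have hF0' : algebraMap K L (F.coeff 0) ≠ 0 := by simpa using hF0
          field_simp at h4
          linear_combination -h4
        · rw [h3 (_ - 1 - 1) (by omega), zero_mul, add_zero] at h4
          exact hb0 ((mul_eq_zero.1 h4).resolve_right hc0)
      · intro i hi
        rw [coeff_add, hp i hi, coeff_mul_monomial, h3 _ (by omega), zero_mul, ite_self, add_zero]
    · have hb2 : b.coeff 2 = 0 := by simpa [hsk2] using h2 1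
      refine ⟨?_, hb2⟩
      -- Here sk ≥ 3, so b has no x^(sk) term, and b in the code gives η ρ(b_0) = 0.
      rw [h3 _ (by omega)] at hb'
      have := (mul_eq_zero.1 hb'.symm).resolve_left hη0
      exact (map_eq_zero_iff ρ ρ.injective).1 this

/-- The mirror argument with xA = b. Moving coefficients past x introduces `σ.symm`, and the
exceptional case now forces ρ to be the identity. -/
theorem eq_const_of_mem_rightIdealiser (hσ : ∀ τ : L ≃ₐ[K] L, τ ∈ Subgroup.zpowers σ)
    (hF : F.Monic) (hF0 : F.coeff 0 ≠ 0) {k : ℕ} (hk : 2 * k ≤ Module.finrank K L)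
    (hsk : 1 < F.natDegree * k) {η : L}
    (hη : F.natDegree * k = 2 → Algebra.norm K η * F.coeff 0 ^ k ≠ 1) (ρ : L ≃+* L)
    {A : SkewQuot σ F} (hA : A ∈ rightIdealiser (code σ F k η (ρ : L →+ L))) :
    ∃ b, A = const σ F b := by
  have hs : 0 < F.natDegree := Nat.pos_of_ne_zero fun h => by rw [h] at hsk; omega
  have hns : 2 * (F.natDegree * k) ≤ Module.finrank K L * F.natDegree := by
    calc 2 * (F.natDegree * k) = 2 * k * F.natDegree := by ring
      _ ≤ _ := Nat.mul_le_mul_right _ hk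
  have hlt : F.natDegree * k < Module.finrank K L * F.natDegree := by omega
  obtain ⟨b, hb, hb', hAb⟩ := hA _ (toQuot_monomial_mem_code one_pos hsk 1)
  change toQuot σ F b = root σ F * A at hAb
  have key : ∀ β, (∀ i, F.natDegree * k < i →
        (monomial σ (F.natDegree * k - 2) β * b).coeff i = 0) ∧
      (monomial σ (F.natDegree * k - 2) β * b).coeff (F.natDegree * k) =
        η * ρ ((monomial σ (F.natDegree * k - 2) β * b).coeff 0) := by
    intro β
    refine (toQuot_mem_code_iff (ρ := (ρ : L →+ L)) hF hlt fun i hi => ?_).1 ?_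
    · rw [coeff_monomial_mul, hb _ (by omega), map_zero, mul_zero, ite_self]
    · have h1 : monomial σ (F.natDegree * k - 1) β =
          monomial σ (F.natDegree * k - 2) β * monomial σ 1 1 := by
        rw [monomial_mul_monomial, map_one, mul_one]
        congr 1
        omega
      have h2 := hA _ (toQuot_monomial_mem_code (i := F.natDegree * k - 1) (by omega) (by omega) β)
      rwa [h1, map_mul, mul_assoc, ← root, ← hAb, ← map_mul] at h2
  have h3 : ∀ i, 3 ≤ i → b.coeff i = 0 := by
    intro i hi
    have := (key 1).1 (i + (F.natDegree * k - 2)) (by omega)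
    rwa [coeff_monomial_mul, if_pos (by omega), Nat.add_sub_cancel, one_mul,
      map_eq_zero_iff _ (AlgEquiv.injective _)] at this
  have h2 : ∀ β, β * (σ ^ (F.natDegree * k - 2)) (b.coeff 2) =
      η * ρ (if F.natDegree * k = 2 then β * b.coeff 0 else 0) := by
    intro β
    have := (key β).2
    rw [coeff_monomial_mul, if_pos (by omega), coeff_monomial_mul,
      show F.natDegree * k - (F.natDegree * k - 2) = 2 by omega] at this
    rw [this]
    congr 2
    by_cases h : F.natDegree * k = 2
    · rw [if_pos (by omega), if_pos h, Nat.zero_sub, h, Nat.sub_self, pow_zero,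
        AlgEquiv.one_apply]
    · rw [if_neg (by omega), if_neg h]
  have hbx : b = (C σ (b.coeff 0) + monomial σ 1 (b.coeff 1) + monomial σ 2 (b.coeff 2)) := by
    ext i
    rw [coeff_add, coeff_add, C_apply, coeff_monomial, coeff_monomial, coeff_monomial]
    rcases i with _ | _ | _ | i
    · simp
    · simp
    · simp
    · rw [h3 _ (by omega), if_neg (by omega), if_neg (by omega), if_neg (by omega)]
      simp
  have hAp : A = toQuot σ F (C σ (σ.symm (b.coeff 0)) * invX σ F + C σ (σ.symm (b.coeff 1)) +
      monomial σ 1 (σ.symm (b.coeff 2))) := by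
    apply (isUnit_root hF0).mul_left_cancel
    rw [← hAb]
    conv_lhs => rw [hbx]
    rw [map_add, map_add, map_add, map_add, mul_add, mul_add, map_mul, ← mul_assoc,
      toQuot_C, toQuot_C, toQuot_C, toQuot_monomial, toQuot_monomial, toQuot_monomial,
      root_mul_const, root_mul_const, mul_assoc, root_mul_toQuot_invX hF0, mul_one, pow_one,
      ← mul_assoc, root_mul_const, mul_assoc, ← pow_two, σ.apply_symm_apply, σ.apply_symm_apply,
      σ.apply_symm_apply]
  have hp : ∀ i, Module.finrank K L * F.natDegree ≤ i → (C σ (σ.symm (b.coeff 0)) * invX σ F +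
      C σ (σ.symm (b.coeff 1)) + monomial σ 1 (σ.symm (b.coeff 2))).coeff i = 0 := by
    intro i hi
    rw [coeff_add, coeff_add, coeff_C_mul, coeff_C, coeff_monomial, coeff_invX_of_le hi,
      if_neg (by omega), if_neg (by omega), mul_zero, add_zero, add_zero]
  have htop : (C σ (σ.symm (b.coeff 0)) * invX σ F + C σ (σ.symm (b.coeff 1)) +
      monomial σ 1 (σ.symm (b.coeff 2))).coeff (Module.finrank K L * F.natDegree - 1) =
        σ.symm (b.coeff 0) * algebraMap K L (-(F.coeff 0)⁻¹) := by
    rw [coeff_add, coeff_add, coeff_C_mul, coeff_C, coeff_monomial, coeff_invX_top hF hs,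
      if_neg (by omega), if_neg (by omega), add_zero, add_zero]
  have hc0 : algebraMap K L (-(F.coeff 0)⁻¹) ≠ 0 := by
    rw [Ne, map_eq_zero, neg_eq_zero, inv_eq_zero]
    exact hF0
  suffices h : b.coeff 0 = 0 ∧ b.coeff 2 = 0 by
    refine ⟨σ.symm (b.coeff 1), ?_⟩
    rw [hAp, h.1, h.2, map_zero, map_zero, zero_mul, zero_add, monomial_zero_right, add_zero,
      toQuot_C]
  by_cases hη0 : η = 0
  · have hb2 : b.coeff 2 = 0 :=
      (map_eq_zero_iff (σ ^ (F.natDegree * k - 2)) (AlgEquiv.injective _)).1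
        (by simpa [hη0] using h2 1)
    refine ⟨?_, hb2⟩
    have h1 := hA _ (toQuot_C_add_monomial_mem_code (by omega) 1)
    rw [hη0, zero_mul, monomial_zero_right, add_zero, map_one, map_one, one_mul, hAp,
      toQuot_mem_code_iff hF hlt hp] at h1
    have h4 := h1.1 _ (show _ < Module.finrank K L * F.natDegree - 1 by omega)
    rw [htop] at h4
    simpa using (mul_eq_zero.1 h4).resolve_right hc0
  · by_cases hsk2 : F.natDegree * k = 2
    · have hb2 : b.coeff 2 = η * ρ (b.coeff 0) := by simpa [hsk2] using h2 1
      suffices hb0 : b.coeff 0 = 0 from ⟨hb0, by rw [hb2, hb0, map_zero, mul_zero]⟩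
      by_contra hb0
      have hρ : ∀ β, ρ β = β := by
        intro β
        have h4 := h2 β
        rw [if_pos hsk2, hsk2, Nat.sub_self, pow_zero, AlgEquiv.one_apply, hb2, map_mul] at h4
        have h5 : η * ρ (b.coeff 0) ≠ 0 := mul_ne_zero hη0 fun h => hb0 (by simpa using h)
        apply mul_right_cancel₀ h5
        linear_combination -h4
      have h1 := hA _ (toQuot_C_add_monomial_mem_code (by omega) 1)
      have h5 : monomial σ 2 η = monomial σ 1 η * monomial σ 1 1 := by
        rw [monomial_mul_monomial, map_one, mul_one]
      have h6 : ((ρ : L →+ L) 1 : L) = 1 := map_one ρ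
      rw [h6, mul_one, map_one, hsk2, h5, map_add, map_one, add_mul, one_mul, map_mul,
        mul_assoc, ← root, ← hAb, hAp, ← map_mul, ← map_add, toQuot_mem_code_iff hF hlt] at h1
      · have h4 := h1.1 (Module.finrank K L * F.natDegree - 1) (by omega)
        rw [coeff_add, htop, coeff_monomial_mul, if_pos (by omega), pow_one] at h4
        by_cases hn4 : Module.finrank K L * F.natDegree = 4
        · apply hb0
          rw [← map_eq_zero_iff σ.symm σ.symm.injective]
          -- The exceptional equation is satisfied by c = σ⁻¹(b_0).
          refine eq_zero_of_eq_mul_apply_sq hσ hsk2 hn4 (hη hsk2) ?_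
          rw [hn4, show 4 - 1 - 1 = 2 from rfl, hb2, hρ, map_mul, map_neg, map_inv₀] at h4
          rw [σ.apply_symm_apply]
          have hF0' : algebraMap K L (F.coeff 0) ≠ 0 := by simpa using hF0
          field_simp at h4
          linear_combination -h4
        · rw [h3 (_ - 1 - 1) (by omega), map_zero, mul_zero, add_zero] at h4
          exact hb0 (by simpa using (mul_eq_zero.1 h4).resolve_right hc0)
      · intro i hi
        rw [coeff_add, hp i hi, coeff_monomial_mul, h3 _ (by omega), map_zero, mul_zero, ite_self,
          add_zero]
    · have hb2 : b.coeff 2 = 0 :=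
        (map_eq_zero_iff (σ ^ (F.natDegree * k - 2)) (AlgEquiv.injective _)).1
          (by simpa [hsk2] using h2 1)
      refine ⟨?_, hb2⟩
      rw [h3 _ (by omega)] at hb'
      have := (mul_eq_zero.1 hb'.symm).resolve_left hη0
      exact (map_eq_zero_iff ρ ρ.injective).1 this

end SkewPoly

end

section

/-! ### Transport of the invariants along an equivalence. -/

section Transfer

variable {R M : Type*} [Ring R] [Ring M]

theorem nonempty_ringEquiv_of_mem_iff (f : R →+* M) (hf : Function.Injective f) (U : Subring M)
    (h : ∀ y, y ∈ U ↔ ∃ t, f t = y) : Nonempty (U ≃+* R) := by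
  obtain rfl : U = f.range := by
    ext y
    rw [h, RingHom.mem_range]
  exact ⟨(RingEquiv.ofBijective f.rangeRestrict
    ⟨fun a b hab => hf (congrArg Subtype.val hab), f.rangeRestrict_surjective⟩).symm⟩

/-- Conjugation by a unit, as a ring automorphism. -/
def unitConj (A : Mˣ) : M ≃+* M :=
  MulSemiringAction.toRingEquiv (ConjAct Mˣ) M (ConjAct.toConjAct A)

theorem unitConj_apply (A : Mˣ) (y : M) : unitConj A y = A * y * ↑A⁻¹ := by
  rw [unitConj, MulSemiringAction.toRingEquiv_apply_apply, ConjAct.units_smul_def,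
    ConjAct.ofConjAct_toConjAct]

theorem unitConj_of_mem_center (A : Mˣ) {y : M} (hy : y ∈ Subring.center M) :
    unitConj A y = y := by
  rw [unitConj_apply, Subring.mem_center_iff.1 hy, mul_assoc, Units.mul_inv, mul_one]

theorem mem_center_of_unitConj_mem_center {A : Mˣ} {y : M}
    (hy : unitConj A y ∈ Subring.center M) : y ∈ Subring.center M := by
  have h := unitConj_of_mem_center A⁻¹ hy
  rw [unitConj_apply, unitConj_apply, inv_inv, mul_assoc, mul_assoc, Units.inv_mul, mul_one,
    Units.inv_mul_cancel_left] at h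
  rwa [h, ← unitConj_apply]

theorem map_mem_center_iff (ψ : R ≃+* M) {a : R} :
    ψ a ∈ Subring.center M ↔ a ∈ Subring.center R := by
  simp only [Subring.mem_center_iff]
  refine ⟨fun h g => ψ.injective ?_, fun h g => ?_⟩
  · rw [map_mul, map_mul, h]
  · obtain ⟨g, rfl⟩ := ψ.surjective g
    rw [← map_mul, ← map_mul, h]

variable {S : AddSubgroup R} {C' : AddSubgroup M} {ψ : R ≃+* M} {A B : Mˣ}

theorem mem_leftIdealiser_iff_exists (hC : ∀ Y, Y ∈ C' ↔ ∃ X ∈ S, Y = A * ψ X * B) {Y : M} :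
    Y ∈ leftIdealiser C' ↔ ∃ a ∈ leftIdealiser S, unitConj A (ψ a) = Y := by
  constructor
  · intro hY
    obtain ⟨y, rfl⟩ := (unitConj A).surjective Y
    obtain ⟨a, rfl⟩ := ψ.surjective y
    refine ⟨a, fun X hX => ?_, rfl⟩
    obtain ⟨X', hX', h⟩ := (hC _).1 (hY _ ((hC _).2 ⟨X, hX, rfl⟩))
    rw [unitConj_apply, mul_assoc (A : M), mul_assoc (A : M), mul_assoc (A : M),
      mul_assoc (A : M), Units.mul_right_inj, mul_assoc (ψ a), Units.inv_mul_cancel_left,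
      ← mul_assoc, Units.mul_left_inj, ← map_mul] at h
    rwa [ψ.injective h]
  · rintro ⟨a, ha, rfl⟩ Z hZ
    obtain ⟨X, hX, rfl⟩ := (hC _).1 hZ
    refine (hC _).2 ⟨a * X, ha X hX, ?_⟩
    rw [unitConj_apply, map_mul]
    simp only [mul_assoc, Units.inv_mul_cancel_left]

theorem mem_rightIdealiser_iff_exists (hC : ∀ Y, Y ∈ C' ↔ ∃ X ∈ S, Y = A * ψ X * B) {Y : M} :
    Y ∈ rightIdealiser C' ↔ ∃ a ∈ rightIdealiser S, unitConj B⁻¹ (ψ a) = Y := by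
  constructor
  · intro hY
    obtain ⟨y, rfl⟩ := (unitConj B⁻¹).surjective Y
    obtain ⟨a, rfl⟩ := ψ.surjective y
    refine ⟨a, fun X hX => ?_, rfl⟩
    obtain ⟨X', hX', h⟩ := (hC _).1 (hY _ ((hC _).2 ⟨X, hX, rfl⟩))
    rw [unitConj_apply, inv_inv, mul_assoc (A : M), mul_assoc (A : M), mul_assoc (A : M),
      Units.mul_right_inj, mul_assoc (ψ X), ← mul_assoc (B : M), Units.mul_inv_cancel_left,
      ← mul_assoc, Units.mul_left_inj, ← map_mul] at h
    rwa [ψ.injective h]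
  · rintro ⟨a, ha, rfl⟩ Z hZ
    obtain ⟨X, hX, rfl⟩ := (hC _).1 hZ
    refine (hC _).2 ⟨X * a, ha X hX, ?_⟩
    rw [unitConj_apply, map_mul, inv_inv]
    simp only [mul_assoc, Units.mul_inv_cancel_left]

/-- If y commutes with every AψXB, then (A⁻¹yA) ψX = ψX (ByB⁻¹). The two conjugates may differ,
hence the two-sided hypothesis `hS`. -/
theorem centraliser_eq_center (hC : ∀ Y, Y ∈ C' ↔ ∃ X ∈ S, Y = A * ψ X * B)
    (hS : ∀ c d, (∀ X ∈ S, c * X = X * d) → c ∈ Subring.center R) :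
    centraliser C' = Subring.center M := by
  refine le_antisymm (fun y hy => ?_) (Subring.center_le_centralizer _)
  obtain ⟨z, rfl⟩ := (unitConj A).surjective y
  obtain ⟨c, rfl⟩ := ψ.surjective z
  have hc : c ∈ Subring.center R := by
    refine hS c (ψ.symm (B * unitConj A (ψ c) * ↑B⁻¹)) fun X hX => ψ.injective ?_
    have h := Subring.mem_centralizer_iff.1 hy _ ((hC _).2 ⟨X, hX, rfl⟩)
    rw [unitConj_apply] at h
    rw [map_mul, map_mul, ψ.apply_symm_apply, unitConj_apply, ← Units.mul_right_inj A,
      ← Units.mul_left_inj B]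
    simp only [mul_assoc, Units.inv_mul_cancel_left, Units.inv_mul, mul_one] at h ⊢
    exact h.symm
  rw [unitConj_of_mem_center A ((map_mem_center_iff ψ).2 hc)]
  exact (map_mem_center_iff ψ).2 hc

end Transfer

/-! ### Exact idealisers and the intertwiners of the code in R_F. -/

variable {K L : Type*} [Field K] [Field L] [Algebra K L] {σ : L ≃ₐ[K] L}
  [FiniteDimensional K L] [IsGalois K L] {F : K[X]}

theorem exists_algebraMap_eq_of_fixed (hσ : ∀ τ : L ≃ₐ[K] L, τ ∈ Subgroup.zpowers σ) {b : L}
    (hb : σ b = b) : ∃ a, algebraMap K L a = b := by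
  refine (IsGalois.mem_range_algebraMap_iff_fixed b).2 fun τ => ?_
  have h : Subgroup.zpowers σ ≤ MulAction.stabilizer (L ≃ₐ[K] L) b :=
    Subgroup.zpowers_le.2 hb
  exact h (hσ τ)

namespace SkewPoly

theorem mem_leftIdealiser_code_iff (hσ : ∀ τ : L ≃ₐ[K] L, τ ∈ Subgroup.zpowers σ)
    (hF : F.Monic) (hF0 : F.coeff 0 ≠ 0) {k : ℕ} (hk : 2 * k ≤ Module.finrank K L)
    (hsk : 1 < F.natDegree * k) {η : L}
    (hη : F.natDegree * k = 2 → Algebra.norm K η * F.coeff 0 ^ k ≠ 1) (ρ : L ≃+* L)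
    {A : SkewQuot σ F} : A ∈ leftIdealiser (code σ F k η (ρ : L →+ L)) ↔
      ∃ b, (η ≠ 0 → ρ b = b) ∧ const σ F b = A := by
  have hs : 0 < F.natDegree := Nat.pos_of_ne_zero fun h => by rw [h] at hsk; omega
  have hns : 2 * (F.natDegree * k) ≤ Module.finrank K L * F.natDegree := by
    calc 2 * (F.natDegree * k) = 2 * k * F.natDegree := by ring
      _ ≤ _ := Nat.mul_le_mul_right _ hk
  constructor
  · intro hA
    obtain ⟨b, rfl⟩ := eq_const_of_mem_leftIdealiser hσ hF hF0 hk hsk hη ρ hA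
    refine ⟨b, fun hη0 => ?_, rfl⟩
    -- Comparing the constant and top coefficients of b(1 + η x^(sk)) yields ρ(b) = b.
    have h := hA _ (toQuot_C_add_monomial_mem_code (by omega) 1)
    have h6 : ((ρ : L →+ L) 1 : L) = 1 := map_one ρ
    rw [← toQuot_C, ← map_mul, h6, mul_one, toQuot_mem_code_iff hF (by omega)] at h
    · have h1 := h.2
      rw [coeff_C_mul, coeff_C_mul, coeff_add, coeff_add, coeff_C, coeff_C, coeff_monomial,
        coeff_monomial, if_neg (by omega), if_pos rfl, if_pos rfl, if_neg (by omega), zero_add,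
        add_zero, mul_one, mul_comm] at h1
      exact (mul_left_cancel₀ hη0 h1).symm
    · intro i hi
      rw [coeff_C_mul, coeff_add, coeff_C, coeff_monomial, if_neg (by omega), if_neg (by omega),
        add_zero, mul_zero]
  · rintro ⟨b, hb, rfl⟩ _ ⟨a, ha, ha', rfl⟩
    refine ⟨C σ b * a, fun i hi => ?_, ?_, map_mul (toQuot σ F) _ _⟩
    · rw [coeff_C_mul, ha i hi, mul_zero]
    · rw [coeff_C_mul, coeff_C_mul, ha']
      change b * (η * ρ (a.coeff 0)) = η * ρ (b * a.coeff 0)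
      by_cases h : η = 0
      · rw [h, zero_mul, zero_mul, mul_zero]
      · rw [map_mul, hb h]
        ring

theorem mem_rightIdealiser_code_iff (hσ : ∀ τ : L ≃ₐ[K] L, τ ∈ Subgroup.zpowers σ)
    (hF : F.Monic) (hF0 : F.coeff 0 ≠ 0) {k : ℕ} (hk : 2 * k ≤ Module.finrank K L)
    (hsk : 1 < F.natDegree * k) {η : L}
    (hη : F.natDegree * k = 2 → Algebra.norm K η * F.coeff 0 ^ k ≠ 1) (ρ : L ≃+* L)
    {A : SkewQuot σ F} : A ∈ rightIdealiser (code σ F k η (ρ : L →+ L)) ↔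
      ∃ b, (η ≠ 0 → ρ b = (σ ^ (F.natDegree * k)) b) ∧ const σ F b = A := by
  have hs : 0 < F.natDegree := Nat.pos_of_ne_zero fun h => by rw [h] at hsk; omega
  have hns : 2 * (F.natDegree * k) ≤ Module.finrank K L * F.natDegree := by
    calc 2 * (F.natDegree * k) = 2 * k * F.natDegree := by ring
      _ ≤ _ := Nat.mul_le_mul_right _ hk
  constructor
  · intro hA
    obtain ⟨b, rfl⟩ := eq_const_of_mem_rightIdealiser hσ hF hF0 hk hsk hη ρ hA
    refine ⟨b, fun hη0 => ?_, rfl⟩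
    have h := hA _ (toQuot_C_add_monomial_mem_code (by omega) 1)
    have h6 : ((ρ : L →+ L) 1 : L) = 1 := map_one ρ
    rw [← toQuot_C, ← map_mul, h6, mul_one, toQuot_mem_code_iff hF (by omega)] at h
    · have h1 := h.2
      rw [coeff_mul_C, coeff_mul_C, coeff_add, coeff_add, coeff_C, coeff_C, coeff_monomial,
        coeff_monomial, if_neg (by omega), if_pos rfl, if_pos rfl, if_neg (by omega), zero_add,
        add_zero, one_mul, pow_zero, AlgEquiv.one_apply] at h1
      exact (mul_left_cancel₀ hη0 h1).symm
    · intro i hi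
      rw [coeff_mul_C, coeff_add, coeff_C, coeff_monomial, if_neg (by omega), if_neg (by omega),
        add_zero, zero_mul]
  · rintro ⟨b, hb, rfl⟩ _ ⟨a, ha, ha', rfl⟩
    refine ⟨a * C σ b, fun i hi => ?_, ?_, map_mul (toQuot σ F) _ _⟩
    · rw [coeff_mul_C, ha i hi, zero_mul]
    · rw [coeff_mul_C, coeff_mul_C, ha', pow_zero, AlgEquiv.one_apply]
      change η * ρ (a.coeff 0) * _ = η * ρ (a.coeff 0 * b)
      by_cases h : η = 0
      · rw [h, zero_mul, zero_mul, zero_mul]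
      · rw [map_mul, hb h]
        ring

theorem const_mem_center_iff (hσ : ∀ τ : L ≃ₐ[K] L, τ ∈ Subgroup.zpowers σ)
    (hF : F.Monic) (hFi : Irreducible F) (hF0 : F.coeff 0 ≠ 0) {b : L} :
    const σ F b ∈ Subring.center (SkewQuot σ F) ↔ ∃ a, algebraMap K L a = b := by
  have := nontrivial_skewQuot (σ := σ) hF hFi
  constructor
  · intro h
    refine exists_algebraMap_eq_of_fixed hσ ((const σ F).injective ?_)
    have h1 := Subring.mem_center_iff.1 h (root σ F)
    rw [root_mul_const] at h1
    exact (isUnit_root hF0).mul_right_cancel h1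
  · rintro ⟨a, rfl⟩
    refine mem_center_of_commutes (fun c => ?_) ?_
    · rw [← map_mul, ← map_mul, mul_comm]
    · rw [root_mul_const, AlgEquiv.commutes]

/-- From cx = xd and c(ax) = (ax)d, c commutes with constants, so only c = d is left. If sk > 2 this
follows from testing on x². If sk = 2, δ = c - d satisfies δ = η xδx: when σ² ≠ 1, commuting δ past
constants kills it; when σ² = 1, n = s = 2 and δ is annihilated by a unit from K[y]. -/
theorem mem_center_of_intertwines (hσ : ∀ τ : L ≃ₐ[K] L, τ ∈ Subgroup.zpowers σ)
    (hF : F.Monic) (hFi : Irreducible F) (hF0 : F.coeff 0 ≠ 0) {k : ℕ}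
    (hk : 2 * k ≤ Module.finrank K L) (hsk : 1 < F.natDegree * k) {η : L}
    (hη : F.natDegree * k = 2 → Algebra.norm K η * F.coeff 0 ^ k ≠ 1) (ρ : L ≃+* L)
    (c d : SkewQuot σ F) (h : ∀ X ∈ code σ F k η (ρ : L →+ L), c * X = X * d) :
    c ∈ Subring.center (SkewQuot σ F) := by
  have hs : 0 < F.natDegree := Nat.pos_of_ne_zero fun h => by rw [h] at hsk; omega
  have hcx : c * root σ F = root σ F * d := h _ (toQuot_monomial_mem_code one_pos hsk 1)
  have hc : ∀ a, c * const σ F a = const σ F a * c := by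
    intro a
    have h1 := h _ (toQuot_monomial_mem_code one_pos hsk a)
    rw [toQuot_monomial, pow_one, mul_assoc, ← hcx, ← mul_assoc, ← mul_assoc] at h1
    exact (isUnit_root hF0).mul_right_cancel h1
  suffices hcd : c = d from mem_center_of_commutes hc (by rw [hcx, ← hcd])
  rcases Nat.lt_or_ge 2 (F.natDegree * k) with hsk2 | hsk2
  · have h1 := h _ (toQuot_monomial_mem_code two_pos hsk2 1)
    rw [toQuot_monomial, map_one, one_mul, pow_two, ← mul_assoc, hcx, mul_assoc, mul_assoc] at h1
    have h2 := (isUnit_root hF0).mul_left_cancel h1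
    rw [← hcx] at h2
    exact ((isUnit_root hF0).mul_right_cancel h2).symm
  replace hsk2 : F.natDegree * k = 2 := by omega
  have h1 := h _ (toQuot_C_add_monomial_mem_code (by omega) 1)
  have h6 : ((ρ : L →+ L) 1 : L) = 1 := map_one ρ
  rw [h6, mul_one, hsk2, map_one, map_add, map_one, toQuot_monomial, mul_add, mul_one, add_mul,
    one_mul] at h1
  obtain ⟨δ, hδ⟩ : ∃ δ, δ = c - d := ⟨_, rfl⟩
  suffices h0 : δ = 0 from sub_eq_zero.1 (hδ.symm.trans h0)
  have hδη : δ = const σ F η * (root σ F * δ * root σ F) := by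
    have h2 : c * (const σ F η * root σ F ^ 2) =
        const σ F η * (root σ F * d * root σ F) := by
      rw [← mul_assoc, hc, mul_assoc, pow_two, ← mul_assoc c, hcx]
    have h3 : const σ F η * root σ F ^ 2 * d = const σ F η * (root σ F * c * root σ F) := by
      rw [mul_assoc, pow_two, mul_assoc, ← hcx, mul_assoc]
    rw [h2, h3] at h1
    rw [hδ, mul_sub, sub_mul, mul_sub, sub_eq_sub_iff_add_eq_add, h1]
    abel
  have hdc : ∀ a, d * const σ F a = const σ F a * d := by
    intro a
    apply (isUnit_root hF0).mul_left_cancel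
    rw [← mul_assoc, ← hcx, mul_assoc, root_mul_const, ← mul_assoc, hc, mul_assoc, hcx,
      ← mul_assoc, ← mul_assoc, ← root_mul_const]
  have hδc : ∀ a, δ * const σ F a = const σ F a * δ := by
    intro a
    rw [hδ, sub_mul, mul_sub, hc, hdc]
  by_cases hσ2 : ∀ β, σ (σ β) = β
  · have hn2 : Module.finrank K L = 2 := by
      have ho : orderOf σ = Module.finrank K L := by
        rw [orderOf_eq_card_of_forall_mem_zpowers hσ, IsGalois.card_aut_eq_finrank]
      have hd : orderOf σ ∣ 2 := orderOf_dvd_of_pow_eq_one (AlgEquiv.ext hσ2)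
      rw [ho] at hd
      have := Nat.le_of_dvd two_pos hd
      have hk0 : k ≠ 0 := by rintro rfl; omega
      omega
    have hk1 : k = 1 := by
      have hk0 : k ≠ 0 := by rintro rfl; omega
      omega
    subst hk1
    rw [mul_one] at hsk2
    replace hη := hη (by omega)
    rw [pow_one] at hη
    have hy : root σ F * root σ F = toQuot σ F (centralHom σ (Polynomial.X : K[X])) := by
      rw [← root_pow_finrank, hn2, pow_two]
    have hdx : d * root σ F = root σ F * c := by
      apply (isUnit_root hF0).mul_left_cancel
      rw [← mul_assoc, ← hcx, mul_assoc, ← mul_assoc (root σ F), hy, central_mul_comm]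
    have hxδ : root σ F * δ = -(δ * root σ F) := by
      rw [hδ, mul_sub, sub_mul, hdx, hcx, neg_sub]
    have hδy : δ = -(const σ F η * toQuot σ F (centralHom σ (Polynomial.X : K[X])) * δ) := by
      conv_lhs => rw [hδη, hxδ, neg_mul, mul_assoc, hy, central_mul_comm, mul_neg, ← mul_assoc]
    obtain ⟨T, hT⟩ := exists_algebraMap_eq_of_fixed hσ (b := η + σ η) (by
      rw [map_add, hσ2, add_comm])
    have hN : algebraMap K L (Algebra.norm K η) = η * σ η := by
      rw [algebraMap_norm_eq_prod_range hσ, hn2]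
      simp [Finset.prod_range_succ]
    -- This is (1 + ηy)(1 + σ(η)y). If the quadratic F divided it, the quotient would be the
    -- constant N(η), and comparing constant terms would give N(η) F_0 = 1.
    have hP : ¬ F ∣ 1 + Polynomial.C T * Polynomial.X +
        Polynomial.C (Algebra.norm K η) * Polynomial.X ^ 2 := by
      rintro ⟨Q, hQ⟩
      have hQ0 : Q.natDegree = 0 := by
        have hdeg : (1 + Polynomial.C T * Polynomial.X +
            Polynomial.C (Algebra.norm K η) * Polynomial.X ^ 2).natDegree ≤ 2 := by
          compute_degree
        by_cases hQz : Q = 0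
        · rw [hQz, natDegree_zero]
        · rw [hQ, hF.natDegree_mul' hQz, hsk2] at hdeg
          omega
      rw [Polynomial.eq_C_of_natDegree_eq_zero hQ0] at hQ
      have e0 := congrArg (fun p => Polynomial.coeff p 0) hQ
      have e2 := congrArg (fun p => Polynomial.coeff p 2) hQ
      have hF2 : F.coeff 2 = 1 := by rw [← hsk2, Polynomial.coeff_natDegree, hF.leadingCoeff]
      simp only [Polynomial.coeff_add, Polynomial.coeff_one, Polynomial.coeff_C_mul, Polynomial.coeff_X,
        Polynomial.coeff_X_pow, Polynomial.coeff_mul_C] at e0 e2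
      norm_num at e0 e2
      rw [hF2, one_mul] at e2
      apply hη
      rw [e2, mul_comm]
      exact e0.symm
    have hu := isUnit_toQuot_centralHom (σ := σ) hFi hP
    apply hu.mul_left_cancel
    rw [mul_zero]
    -- Multiply δ = -ηyδ by x on the left and use xδ = -δx.
    have hδy' : δ = -(const σ F (σ η) * toQuot σ F (centralHom σ (Polynomial.X : K[X])) * δ) := by
      have h2 : root σ F * δ = -(const σ F (σ η) *
          toQuot σ F (centralHom σ (Polynomial.X : K[X])) * (root σ F * δ)) := by
        conv_lhs => rw [hδy]
        rw [mul_neg, ← mul_assoc, ← mul_assoc, root_mul_const, mul_assoc (const σ F (σ η)),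
          central_mul_comm, ← mul_assoc, mul_assoc _ (root σ F)]
      rw [hxδ, mul_neg, neg_inj, ← mul_assoc, ← neg_mul] at h2
      exact (isUnit_root hF0).mul_right_cancel h2
    have hfac : toQuot σ F (centralHom σ (1 + Polynomial.C T * Polynomial.X +
        Polynomial.C (Algebra.norm K η) * Polynomial.X ^ 2)) =
        (1 + const σ F η * toQuot σ F (centralHom σ (Polynomial.X : K[X]))) *
        (1 + const σ F (σ η) * toQuot σ F (centralHom σ (Polynomial.X : K[X]))) := by
      simp only [map_add, map_mul, map_one, map_pow, ← const_algebraMap, hT, hN]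
      have hz := central_mul_comm (Polynomial.X : K[X]) (const σ F (σ η))
      generalize toQuot σ F (centralHom σ (Polynomial.X : K[X])) = z at hz ⊢
      rw [add_mul 1 (const σ F η * z), one_mul, mul_add, mul_one, mul_assoc (const σ F η) z,
        ← mul_assoc z, ← hz]
      noncomm_ring
    have h3 : (1 + const σ F (σ η) * toQuot σ F (centralHom σ (Polynomial.X : K[X]))) * δ = 0 := by
      rw [add_mul, one_mul]
      exact eq_neg_iff_add_eq_zero.1 hδy'
    rw [hfac, mul_assoc, h3, mul_zero]
  · push Not at hσ2
    obtain ⟨β, hβ⟩ := hσ2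
    -- Moving β leftwards through η xδx passes two factors x, which replaces it by σ²(β).
    have h2 : const σ F β * δ = const σ F (σ (σ β)) * δ := by
      rw [← hδc]
      conv_lhs => rw [hδη]
      conv_rhs => rw [hδη]
      rw [mul_assoc, mul_assoc, mul_assoc, root_mul_const, ← mul_assoc δ, hδc, ← mul_assoc,
        ← mul_assoc, ← mul_assoc, mul_assoc (const σ F η), root_mul_const]
      simp only [← mul_assoc, ← map_mul]
      rw [mul_comm η]
    rw [← sub_eq_zero, ← sub_mul, ← map_sub] at h2
    have hu : IsUnit (const σ F (β - σ (σ β))) :=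
      (IsUnit.mk0 _ (sub_ne_zero.2 hβ.symm)).map (const σ F)
    exact hu.mul_left_cancel (h2.trans (mul_zero _).symm)

end SkewPoly

end

/-- For sk = 2 the sign is 1, and transitivity of the norm makes the given quantity the norm from K
to K' of N(η) F_0^k. -/
theorem norm_mul_pow_ne_one_of_tower {K' K L : Type*} [Field K'] [Field K] [Field L]
    [Algebra K' K] [Algebra K L] [Algebra K' L] [IsScalarTower K' K L] {η : L} {a : K} {j n k : ℕ}
    (hη : Algebra.norm K' η * Algebra.norm K' ((-1 : K) ^ (j * (n - 1)) * a ^ k) ≠ 1)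
    (hj : j = 2) : Algebra.norm K η * a ^ k ≠ 1 := by
  intro h
  apply hη
  rw [hj, pow_mul, neg_one_sq, one_pow, one_mul, ← Algebra.norm_norm (S := K), ← map_mul, h,
    map_one]

theorem coeff_zero_ne_zero_of_irreducible {K : Type*} [Field K] {F : K[X]} (hFm : F.Monic)
    (hFi : Irreducible F) (hFX : F ≠ Polynomial.X) : F.coeff 0 ≠ 0 := fun h =>
  hFX <| (eq_of_monic_of_associated Polynomial.monic_X hFm <|
    Polynomial.irreducible_X.associated_of_dvd hFi (Polynomial.X_dvd_iff.2 h)).symm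

end SkewCode

end

/-! ### The four invariants of an equivalent code. -/

theorem mainTheorem3
    {K' K L : Type*} [Field K'] [Field K] [Field L] [Algebra K' K] [Algebra K L] [Algebra K' L]
    [IsScalarTower K' K L] [FiniteDimensional K' K] [FiniteDimensional K L] [IsGalois K L]
    (σ : L ≃ₐ[K] L) (hσ : ∀ τ : L ≃ₐ[K] L, τ ∈ Subgroup.zpowers σ)
    (ρ : L ≃ₐ[K'] L) (η : L)
    (F : Polynomial K) (hFm : F.Monic) (hFi : Irreducible F) (hFX : F ≠ Polynomial.X)
    (n s k : ℕ) (hn : Module.finrank K L = n) (hs : F.natDegree = s)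
    (hk : 2 * k ≤ n) (hsk : 1 < s * k)
    (hη : Algebra.norm K' η *
      Algebra.norm K' ((-1 : K) ^ (s * k * (n - 1)) * F.coeff 0 ^ k) ≠ 1)
    {D : Type*} [DivisionRing D] {m : ℕ}
    (φ : SkewCode.SkewQuot σ F ≃+* Matrix (Fin m) (Fin m) D)
    (C' : AddSubgroup (Matrix (Fin m) (Fin m) D))
    (hC' : SkewCode.Equivalent
      ((SkewCode.code σ F k η (ρ : L →+ L)).map
        (φ : SkewCode.SkewQuot σ F →+ Matrix (Fin m) (Fin m) D)) C')
    (h1 : (1 : Matrix (Fin m) (Fin m) D) ∈ C') :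
    (η ≠ 0 →
      Nonempty (SkewCode.leftIdealiser C' ≃+* SkewCode.fixedSubfield (ρ : L ≃+* L)) ∧
      Nonempty (SkewCode.rightIdealiser C' ≃+*
        SkewCode.fixedSubfield (((σ ^ (s * k) : L ≃ₐ[K] L) : L ≃+* L).trans (ρ.symm : L ≃+* L))) ∧
      Nonempty (SkewCode.centraliser C' ≃+* Subring.center (SkewCode.SkewQuot σ F)) ∧
      Nonempty (SkewCode.centre C' ≃+*
        (SkewCode.fixedSubfield (ρ : L ≃+* L)).comap (algebraMap K L))) ∧
    (η = 0 →
      (∀ ρ' : L →+ L, SkewCode.code σ F k 0 (ρ : L →+ L) = SkewCode.code σ F k 0 ρ') ∧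
      Nonempty (SkewCode.leftIdealiser C' ≃+* L) ∧
      Nonempty (SkewCode.rightIdealiser C' ≃+* L) ∧
      Nonempty (SkewCode.centraliser C' ≃+* Subring.center (SkewCode.SkewQuot σ F)) ∧
      Nonempty (SkewCode.centre C' ≃+* K)) := by
  subst hn hs
  have hF0 := SkewCode.coeff_zero_ne_zero_of_irreducible hFm hFi hFX
  have hη' := SkewCode.norm_mul_pow_ne_one_of_tower hη
  have hnt := SkewCode.SkewPoly.nontrivial_skewQuot (σ := σ) hFm hFi
  obtain ⟨A, B, θ, hC⟩ := hC'
  -- The entrywise automorphism θ is absorbed into the ring isomorphism.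
  let ψ : SkewCode.SkewQuot σ F ≃+* Matrix (Fin m) (Fin m) D := φ.trans θ.mapMatrix
  have hC : ∀ Y, Y ∈ C' ↔
      ∃ X ∈ SkewCode.code σ F k η ((ρ : L ≃+* L) : L →+ L), Y = A * ψ X * B := by
    intro Y
    rw [← SetLike.mem_coe, hC]
    constructor
    · rintro ⟨_, ⟨X, hX, rfl⟩, rfl⟩
      exact ⟨X, hX, rfl⟩
    · rintro ⟨X, hX, rfl⟩
      exact ⟨_, ⟨X, hX, rfl⟩, rfl⟩
  have hcent := SkewCode.centraliser_eq_center hC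
    (SkewCode.SkewPoly.mem_center_of_intertwines hσ hFm hFi hF0 hk hsk hη' ρ)
  have hcent' : Nonempty (SkewCode.centraliser C' ≃+* Subring.center (SkewCode.SkewQuot σ F)) := by
    rw [hcent]
    exact ⟨Subring.centerCongr φ.symm⟩
  have hl : ∀ Y, Y ∈ SkewCode.leftIdealiser C' ↔ ∃ b, (η ≠ 0 → ρ b = b) ∧
      SkewCode.unitConj A (ψ (SkewCode.SkewPoly.const σ F b)) = Y := by
    intro Y
    rw [SkewCode.mem_leftIdealiser_iff_exists hC]
    simp only [SkewCode.SkewPoly.mem_leftIdealiser_code_iff hσ hFm hF0 hk hsk hη']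
    constructor
    · rintro ⟨_, ⟨b, hb, rfl⟩, rfl⟩
      exact ⟨b, hb, rfl⟩
    · rintro ⟨b, hb, rfl⟩
      exact ⟨_, ⟨b, hb, rfl⟩, rfl⟩
  have hr : ∀ Y, Y ∈ SkewCode.rightIdealiser C' ↔
      ∃ b, (η ≠ 0 → ρ b = (σ ^ (F.natDegree * k)) b) ∧
        SkewCode.unitConj B⁻¹ (ψ (SkewCode.SkewPoly.const σ F b)) = Y := by
    intro Y
    rw [SkewCode.mem_rightIdealiser_iff_exists hC]
    simp only [SkewCode.SkewPoly.mem_rightIdealiser_code_iff hσ hFm hF0 hk hsk hη']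
    constructor
    · rintro ⟨_, ⟨b, hb, rfl⟩, rfl⟩
      exact ⟨b, hb, rfl⟩
    · rintro ⟨b, hb, rfl⟩
      exact ⟨_, ⟨b, hb, rfl⟩, rfl⟩
  -- A central element is fixed by conjugation by A, so the centre is described without it; a
  -- central constant is fixed by σ, hence lies in K.
  have hz : ∀ Y, Y ∈ SkewCode.centre C' ↔
      ∃ a : K, (η ≠ 0 → ρ (algebraMap K L a) = algebraMap K L a) ∧
        ψ (SkewCode.SkewPoly.const σ F (algebraMap K L a)) = Y := by
    intro Y
    rw [SkewCode.centre, Subring.mem_inf, hcent, hl]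
    constructor
    · rintro ⟨⟨b, hb, rfl⟩, hY⟩
      have hb' := SkewCode.mem_center_of_unitConj_mem_center hY
      obtain ⟨a, rfl⟩ := (SkewCode.SkewPoly.const_mem_center_iff hσ hFm hFi hF0).1
        ((SkewCode.map_mem_center_iff ψ).1 hb')
      exact ⟨a, hb, (SkewCode.unitConj_of_mem_center A hb').symm⟩
    · rintro ⟨a, ha, rfl⟩
      have ha' := (SkewCode.map_mem_center_iff ψ).2
        ((SkewCode.SkewPoly.const_mem_center_iff hσ hFm hFi hF0).2 ⟨a, rfl⟩)
      exact ⟨⟨_, ha, SkewCode.unitConj_of_mem_center A ha'⟩, ha'⟩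
  let ι : L →+* Matrix (Fin m) (Fin m) D :=
    (ψ : SkewCode.SkewQuot σ F →+* _).comp (SkewCode.SkewPoly.const σ F)
  have hι : Function.Injective ι := ψ.injective.comp (RingHom.injective _)
  let fl : L →+* Matrix (Fin m) (Fin m) D :=
    (SkewCode.unitConj A : Matrix (Fin m) (Fin m) D →+* _).comp ι
  have hfl : Function.Injective fl := (SkewCode.unitConj A).injective.comp hι
  let fr : L →+* Matrix (Fin m) (Fin m) D :=
    (SkewCode.unitConj B⁻¹ : Matrix (Fin m) (Fin m) D →+* _).comp ι
  have hfr : Function.Injective fr := (SkewCode.unitConj B⁻¹).injective.comp hι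
  constructor
  · intro hη0
    refine ⟨?_, ?_, hcent', ?_⟩
    · refine SkewCode.nonempty_ringEquiv_of_mem_iff (fl.comp (Subfield.subtype _))
        (hfl.comp Subtype.val_injective) _ fun Y => (hl Y).trans ?_
      exact ⟨fun ⟨b, hb, h⟩ => ⟨⟨b, hb hη0⟩, h⟩, fun ⟨⟨b, hb⟩, h⟩ => ⟨b, fun _ => hb, h⟩⟩
    · refine SkewCode.nonempty_ringEquiv_of_mem_iff (fr.comp (Subfield.subtype _))
        (hfr.comp Subtype.val_injective) _ fun Y => (hr Y).trans ?_
      have hfix : ∀ b, ρ b = (σ ^ (F.natDegree * k)) b ↔ b ∈ SkewCode.fixedSubfield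
          (((σ ^ (F.natDegree * k) : L ≃ₐ[K] L) : L ≃+* L).trans (ρ.symm : L ≃+* L)) := fun b =>
        ⟨fun h => (AlgEquiv.symm_apply_eq ρ).2 h.symm, fun h => ((AlgEquiv.symm_apply_eq ρ).1 h).symm⟩
      exact ⟨fun ⟨b, hb, h⟩ => ⟨⟨b, (hfix b).1 (hb hη0)⟩, h⟩,
        fun ⟨⟨b, hb⟩, h⟩ => ⟨b, fun _ => (hfix b).2 hb, h⟩⟩
    · refine SkewCode.nonempty_ringEquiv_of_mem_iff
        ((ι.comp (algebraMap K L)).comp (Subfield.subtype _))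
        ((hι.comp (algebraMap K L).injective).comp Subtype.val_injective) _
        fun Y => (hz Y).trans ?_
      exact ⟨fun ⟨b, hb, h⟩ => ⟨⟨b, hb hη0⟩, h⟩, fun ⟨⟨b, hb⟩, h⟩ => ⟨b, fun _ => hb, h⟩⟩
  · intro hη0
    refine ⟨fun ρ' => ?_, ?_, ?_, hcent', ?_⟩
    · ext c
      change (∃ a, _) ↔ ∃ a, _
      simp only [zero_mul]
    · refine SkewCode.nonempty_ringEquiv_of_mem_iff fl hfl _ fun Y => (hl Y).trans ?_
      exact ⟨fun ⟨b, _, h⟩ => ⟨b, h⟩, fun ⟨b, h⟩ => ⟨b, fun h0 => absurd hη0 h0, h⟩⟩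
    · refine SkewCode.nonempty_ringEquiv_of_mem_iff fr hfr _ fun Y => (hr Y).trans ?_
      exact ⟨fun ⟨b, _, h⟩ => ⟨b, h⟩, fun ⟨b, h⟩ => ⟨b, fun h0 => absurd hη0 h0, h⟩⟩
    · refine SkewCode.nonempty_ringEquiv_of_mem_iff (ι.comp (algebraMap K L))
        (hι.comp (algebraMap K L).injective) _ fun Y => (hz Y).trans ?_
      exact ⟨fun ⟨b, _, h⟩ => ⟨b, h⟩, fun ⟨b, h⟩ => ⟨b, fun h0 => absurd hη0 h0, h⟩⟩
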